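/- **Theorem (Approximate separable invariant decomposition).** Let $n,m,d\ge 0$ be integers and write $[n]=\{0,\dots,n\}$. *Complexes and actions.* A weighted simplicial complex on $[n]$ is a map $\Omega:\mathcal P([n])\to\mathbb N$ with $\Omega(S_1)\mid\Omega(S_2)$ whenever $S_1\subseteq S_2$, and with $\Omega(\{i\})\neq 0$ for all $i$. Its facets are the inclusion-maximal sets $F$ with $\Omega(F)\ne 0$. $\widetilde{\mathcal F}$ denotes the set of multifacets, which contains $\Omega(F)$ copies of every facet $F$, and $\widetilde{\mathcal F}_i$ the set of multifacets whose underlying facet contains $i$. $\Omega$ is connected if any two vertices are joined by a sequence of vertices in which consecutive ones lie in a common facet. An action of a finite group $G$ on $\Omega$ consists of an action on $[n]$ that preserves $\Omega$ and an action on $\widetilde{\mathcal F}$ such that the collapse map, from multifacets to facets, is equivariant. It is free if the action on $\widetilde{\mathcal F}$ is free. *Polynomials.* For $i\in[n]$ let $\mathbf x^{[i]}=(x^{[i]}_0,\dots,x^{[i]}_m)$, and let $\mathcal P^h_{2d}$ be the space of real polynomials in $\mathbf x^{[0]},\dots,\mathbf x^{[n]}$ that are homogeneous of degree $2d$ in each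 block $\mathbf x^{[i]}$. A polynomial $p$ is $G$-invariant if $p(\mathbf x^{[g0]},\dots,\mathbf x^{[gn]})=p(\mathbf x^{[0]},\dots,\mathbf x^{[n]})$ for all $g\in G$, and separable if it is a finite sum of products $p^{[0]}(\mathbf x^{[0]})\cdots p^{[n]}(\mathbf x^{[n]})$ of sums of squares $p^{[i]}$. Put $\|p\|_\infty=\sup|p(\mathbf a^{[0]},\dots,\mathbf a^{[n]})|$, where the $\mathbf a^{[i]}$ range over the Euclidean unit sphere of $\mathbb R^{m+1}$. *Rank.* A separable $(\Omega,G)$-decomposition of $q$ consists of a finite index set $\mathcal I$ and sums of squares $p^{[i]}_\beta$ in $m+1$ variables ($i\in[n]$, $\beta\in\mathcal I^{\widetilde{\mathcal F}_i}$) such that $$q=\sum_{\alpha\in\mathcal I^{\widetilde{\mathcal F}}}\ \prod_{i=0}^n p^{[i]}_{\alpha|_{\widetilde{\mathcal F}_i}}(\mathbf x^{[i]})\qquad\text{and}\qquad p^{[i]}_\beta=p^{[gi]}_{{}^g\beta}\ \text{ for all } i,\beta \text{ and } g\in G,\quad\text{where } {}^g\beta(f)=\beta(g^{-1}f).$$ $\operatorname{sep-rank}_{(\Omega,G)}(q)$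 is the minimal cardinality of $\mathcal I$ among all such decompositions ($\infty$ if there is none). *The number $\mu(p)$.* Let $D=\binom{m+d}{d}$, let $\mathfrak m$ be the tensor product over $i\in[n]$ of the vectors of all monomials of degree $d$ in $\mathbf x^{[i]}$, and let $\mathcal G(M)=\mathfrak m^tM\mathfrak m$ for $M\in\mathrm{Mat}_D(\mathbb R)^{\otimes(n+1)}$. Such an $M$ is separable if it is a finite sum of tensor products of positive semidefinite matrices, and $G$-invariant if it is fixed by the permutations of the tensor factors induced by $G$. Put $$\mu(p)=\inf\{\lambda>0:\ p=\lambda\,\mathcal G(M)\text{ for some separable, } G\text{-invariant } M\text{ with } \operatorname{tr}M\le 1\}.$$ *Claim.* Let $\Omega$ be a connected weighted simplicial complex on $[n]$ with a free action of a finite group $G$, and let $p\in\mathcal P^h_{2d}$ be separable and $G$-invariant. Then the set defining $\mu(p)$ is non-empty (so $\mu(p)<\infty$), and for every $\varepsilon>0$ there is $q\in\mathcal P^h_{2d}$ with $\|p-q\|_\infty<\varepsilon$ and $$\operatorname{sep-rank}_{(\Omega,G)}(q)\le\left\lceil\frac{8e^4\,\mu(p)^2}{\varepsilon^2}\right\rceil\cdot|G|.$$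 -/

import Mathlib

/-- A weighted simplicial complex on the vertex set `{0, …, n}`; every singleton is a simplex. -/
structure WeightedSimplicialComplex (n : ℕ) where
  weight : Finset (Fin (n + 1)) → ℕ
  weight_dvd : ∀ S₁ S₂ : Finset (Fin (n + 1)), S₁ ⊆ S₂ → weight S₁ ∣ weight S₂
  weight_singleton : ∀ i : Fin (n + 1), weight {i} ≠ 0

namespace WeightedSimplicialComplex

variable {n : ℕ} (Ω : WeightedSimplicialComplex n)

/-- The set `S` is a simplex of `Ω`. -/
def IsSimplex (S : Finset (Fin (n + 1))) : Prop := Ω.weight S ≠ 0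

/-- A facet is an inclusion-maximal simplex. -/
def IsFacet (F : Finset (Fin (n + 1))) : Prop := Maximal Ω.IsSimplex F

/-- The set of multifacets: it contains every facet `F` exactly `Ω F` many times. -/
def MultiFacet : Type :=
  Σ F : {F : Finset (Fin (n + 1)) // Ω.IsFacet F}, Fin (Ω.weight F.1)

noncomputable instance : Fintype Ω.MultiFacet := by
  classical exact inferInstanceAs (Fintype (Σ F : {F // Ω.IsFacet F}, Fin (Ω.weight F.1)))

noncomputable instance : DecidableEq Ω.MultiFacet := Classical.decEq _

/-- The collapse map, which sends a copy of a facet to the facet itself. -/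
def collapse {Ω : WeightedSimplicialComplex n} (f : Ω.MultiFacet) : Finset (Fin (n + 1)) := f.1.1

/-- The multifacets that contain the vertex `i`. -/
def MultiFacetAt (i : Fin (n + 1)) : Type := {f : Ω.MultiFacet // i ∈ collapse f}

/-- Two vertices are neighbours if some facet contains both. -/
def Neighbours (i j : Fin (n + 1)) : Prop := ∃ F, Ω.IsFacet F ∧ i ∈ F ∧ j ∈ F

/-- Any two vertices are joined by a sequence of neighbours. -/
def IsConnected : Prop := ∀ i j : Fin (n + 1), Relation.ReflTransGen Ω.Neighbours i j

/-- An action of `G` on the vertices together with an action of `G` on the multifacets form an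
action of `G` on `Ω`: the weights are invariant and the collapse map is equivariant. -/
structure IsGroupAction (G : Type*) [Group G] [MulAction G (Fin (n + 1))]
    [MulAction G Ω.MultiFacet] : Prop where
  weight_smul : ∀ (g : G) (S : Finset (Fin (n + 1))),
    Ω.weight (S.image fun i => g • i) = Ω.weight S
  collapse_smul : ∀ (g : G) (f : Ω.MultiFacet),
    collapse (g • f) = (collapse f).image fun i => g • i

/-- The action of `G` on `Ω` is free, i.e. all stabilizers of multifacets are trivial. -/
def IsFreeAction (G : Type*) [Group G] [MulAction G Ω.MultiFacet] : Prop :=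
  ∀ (g : G) (f : Ω.MultiFacet), g • f = f → g = 1

variable {Ω}

/-- The restriction of `α` from all multifacets to those that contain `i`. -/
def restrict {I : Type*} (α : Ω.MultiFacet → I) (i : Fin (n + 1)) : Ω.MultiFacetAt i → I :=
  fun f => α f.1

theorem IsGroupAction.mem_collapse_inv_smul {G : Type*} [Group G] [MulAction G (Fin (n + 1))]
    [MulAction G Ω.MultiFacet] (h : Ω.IsGroupAction G) (g : G) {i : Fin (n + 1)}
    {f : Ω.MultiFacet} (hf : g • i ∈ collapse f) : i ∈ collapse (g⁻¹ • f) := by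
  rw [h.collapse_smul, Finset.mem_image]
  exact ⟨g • i, hf, inv_smul_smul g i⟩

/-- The translate `ᵍβ = β (g⁻¹ ·)` of a function `β` on the multifacets that contain `i`; it is
a function on the multifacets that contain `g i`. -/
def translate {G : Type*} [Group G] [MulAction G (Fin (n + 1))] [MulAction G Ω.MultiFacet]
    (h : Ω.IsGroupAction G) {I : Type*} (g : G) {i : Fin (n + 1)} (β : Ω.MultiFacetAt i → I) :
    Ω.MultiFacetAt (g • i) → I :=
  fun f => β ⟨g⁻¹ • f.1, h.mem_collapse_inv_smul g f.2⟩

end WeightedSimplicialComplex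

/-- Real polynomials in the `m + 1` variables of one site. -/
abbrev LocalPoly (m : ℕ) : Type := MvPolynomial (Fin (m + 1)) ℝ

/-- Real polynomials in the variables `x^{[i]}_k`, written `(i, k)`, of the sites `0, …, n`. -/
abbrev GlobalPoly (n m : ℕ) : Type := MvPolynomial (Fin (n + 1) × Fin (m + 1)) ℝ

/-- The local polynomial `f`, evaluated in the variables `x^{[i]}` of site `i`. -/
noncomputable def atSite {n m : ℕ} (i : Fin (n + 1)) (f : LocalPoly m) : GlobalPoly n m :=
  MvPolynomial.rename (fun k => (i, k)) f

/-- Multi-homogeneity: `p` is homogeneous of degree `e` in the variables of each site. -/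
def IsMultiHomogeneous {n m : ℕ} (e : ℕ) (p : GlobalPoly n m) : Prop :=
  ∀ s ∈ p.support, ∀ i : Fin (n + 1), ∑ k : Fin (m + 1), s (i, k) = e

/-- `p (x^{[g 0]}, …, x^{[g n]}) = p (x^{[0]}, …, x^{[n]})` for all `g`. -/
def IsInvariantPoly (G : Type*) [Group G] {n m : ℕ} [MulAction G (Fin (n + 1))]
    (p : GlobalPoly n m) : Prop :=
  ∀ g : G, MvPolynomial.rename (fun v : Fin (n + 1) × Fin (m + 1) => (g • v.1, v.2)) p = p

/-- Membership in the separable cone generated by the local sums-of-squares cones. -/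
def IsSeparablePoly {n m : ℕ} (p : GlobalPoly n m) : Prop :=
  ∃ (r : ℕ) (f : Fin r → Fin (n + 1) → LocalPoly m),
    (∀ j i, IsSumSq (f j i)) ∧ p = ∑ j, ∏ i, atSite i (f j i)

open WeightedSimplicialComplex in
/-- `P` is a separable `(Ω, G)`-decomposition of `p` with the finite index set `I` and with
respect to the local sums-of-squares cones. -/
structure IsSeparableDecomposition {n m : ℕ} {Ω : WeightedSimplicialComplex n} {G : Type*}
    [Group G] [MulAction G (Fin (n + 1))] [MulAction G Ω.MultiFacet] (hΩ : Ω.IsGroupAction G)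
    (p : GlobalPoly n m) {I : Type*} [Fintype I]
    (P : (i : Fin (n + 1)) → (Ω.MultiFacetAt i → I) → LocalPoly m) : Prop where
  sum_eq : p = ∑ α : Ω.MultiFacet → I, ∏ i, atSite i (P i (restrict α i))
  symm : ∀ (i : Fin (n + 1)) (g : G) (β : Ω.MultiFacetAt i → I),
    P i β = P (g • i) (translate hΩ g β)
  isSumSq : ∀ (i : Fin (n + 1)) (β : Ω.MultiFacetAt i → I), IsSumSq (P i β)

/-- The separable `(Ω, G)`-rank: the least cardinality of the index set of a separable
`(Ω, G)`-decomposition of `p`, and `∞` if there is none. -/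
noncomputable def sepRank {n m : ℕ} {Ω : WeightedSimplicialComplex n} {G : Type*}
    [Group G] [MulAction G (Fin (n + 1))] [MulAction G Ω.MultiFacet] (hΩ : Ω.IsGroupAction G)
    (p : GlobalPoly n m) : ℕ∞ :=
  sInf {k : ℕ∞ | ∃ r : ℕ, k = r ∧
    ∃ P : (i : Fin (n + 1)) → (Ω.MultiFacetAt i → Fin r) → LocalPoly m,
      IsSeparableDecomposition hΩ p P}

/-- The exponents of the monomials of degree `d` in `m + 1` variables. -/
abbrev MonomialIndex (m d : ℕ) : Type :=
  ↥(Finset.finsuppAntidiag (Finset.univ : Finset (Fin (m + 1))) d)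

/-- The space `M_D ⊗ ⋯ ⊗ M_D` (`n + 1` factors) of real matrices, where `D` is the number of
monomials of degree `d`; rows and columns are indexed by tuples of monomials. -/
abbrev GramMatrix (n m d : ℕ) : Type :=
  Matrix (Fin (n + 1) → MonomialIndex m d) (Fin (n + 1) → MonomialIndex m d) ℝ

/-- The entry of the tensor product of the monomial vectors of all sites at position `a`. -/
noncomputable def tensorMonomial {n m d : ℕ} (a : Fin (n + 1) → MonomialIndex m d) :
    GlobalPoly n m :=
  ∏ i, atSite i (MvPolynomial.monomial (a i).1 (1 : ℝ))

/-- The Gram map `M ↦ 𝔪ᵀ M 𝔪`, where `𝔪` is the vector of all `tensorMonomial a`. -/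
noncomputable def gramMap {n m d : ℕ} (M : GramMatrix n m d) : GlobalPoly n m :=
  ∑ a, ∑ b, MvPolynomial.C (M a b) * (tensorMonomial a * tensorMonomial b)

/-- `M` is a finite sum of tensor products of positive semidefinite matrices. -/
def IsSeparableMatrix {n m d : ℕ} (M : GramMatrix n m d) : Prop :=
  ∃ (r : ℕ) (A : Fin r → Fin (n + 1) → Matrix (MonomialIndex m d) (MonomialIndex m d) ℝ),
    (∀ j i, (A j i).PosSemidef) ∧ ∀ a b, M a b = ∑ j, ∏ i, A j i (a i) (b i)

/-- `M` is invariant under the permutations of the tensor factors induced by `G`. -/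
def IsInvariantMatrix (G : Type*) [Group G] {n m d : ℕ} [MulAction G (Fin (n + 1))]
    (M : GramMatrix n m d) : Prop :=
  ∀ (g : G) (a b : Fin (n + 1) → MonomialIndex m d),
    M (fun i => a (g • i)) (fun i => b (g • i)) = M a b

/-- The set of all `t > 0` with `p = t 𝒢(M)` for a `G`-invariant separable matrix `M` of trace at
most `1`. -/
def gramScalings (G : Type*) [Group G] {n m : ℕ} [MulAction G (Fin (n + 1))] (d : ℕ)
    (p : GlobalPoly n m) : Set ℝ :=
  {t | 0 < t ∧ ∃ M : GramMatrix n m d, IsSeparableMatrix M ∧ M.trace ≤ 1 ∧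
    IsInvariantMatrix G M ∧ p = MvPolynomial.C t * gramMap M}

/-- The number `μ(p)`. -/
noncomputable def gramMu (G : Type*) [Group G] {n m : ℕ} [MulAction G (Fin (n + 1))] (d : ℕ)
    (p : GlobalPoly n m) : ℝ :=
  sInf (gramScalings G d p)

/-- The maximum of `|p|` on the product of `n + 1` Euclidean unit spheres in `ℝ^(m+1)`. -/
noncomputable def sphereNorm {n m : ℕ} (p : GlobalPoly n m) : ℝ :=
  ⨆ a : Fin (n + 1) → Metric.sphere (0 : EuclideanSpace ℝ (Fin (m + 1))) 1,
    |MvPolynomial.eval (fun v : Fin (n + 1) × Fin (m + 1) => (a v.1).1 v.2) p|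

/-!
*Finiteness of `μ(p)`.* In a separable representation of `p` every summand is pointwise at most
`p`. If none of its factors vanishes, scaling the variables of one site shows that every factor
grows at most like `t ^ (2 * d)` along lines through the origin, for `t → ∞` as well as for
`t → 0`. A polynomial whose square obeys such a bound is homogeneous of degree `d`, so all factors
are sums of squares of forms of degree `d`, that is, Gram polynomials `𝔪ᵀ A 𝔪` of positive
semidefinite matrices (`IsSeparablePoly.exists_localGram`). Averaging the Gram matrix of `p` over
`G` and dividing by one plus its trace yields a scaling (`gramScalings_nonempty`).

*Approximation.* Let `p = t 𝒢(M)` with `M` separable of trace at most `1`. Then `M` lies in the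
convex hull of the tensor products of positive semidefinite matrices that have trace at most `1`,
and these are in the unit ball of the Hilbert-Schmidt norm
(`IsSeparableMatrix.entries_mem_convexHull`). By the approximate Carathéodory
theorem (`exists_norm_sq_sum_sub_le_of_mem_convexHull`) the mean of `k` of them is within `2 / √k`
of `M`. On the product of the unit spheres the tensor product of the monomial vectors has norm at
most `1`, so there the Gram map is bounded by the Hilbert-Schmidt norm (`abs_eval_gramMap_le`). As
`p` is invariant, averaging over `G` preserves the error bound `2 t / √k`
(`exists_orbit_sum_approx`). With `t < 2 μ(p)` and `k ≥ 8 e⁴ μ(p)² / ε²` it is below `ε`, since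
`16 ≤ 8 e⁴`.

*Rank.* The approximation is a sum of `k` orbit sums of elementary products. A free action admits an
equivariant map `φ` from the multifacets to `G`. Label the multifacets by pairs in `Fin k × G`, and
let the local polynomial at `i` vanish unless the labels around `i` are `f ↦ (j, (φ f)⁻¹ h)` for
some `(j, h)`. Since `Ω` is connected, the only labellings that contribute are the `k |G|` ones that
are of this form globally, and these contribute the `k |G|` terms of the orbit sums
(`sepRank_sum_orbit_le`).
-/

/-! ### Gram matrices of one site and their tensor products -/

open MvPolynomial in
/-- The Gram map of one site: `localGram A = 𝔪ᵀ A 𝔪` for the vector `𝔪` of all monomials of degree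
`d` in `m + 1` variables. -/
noncomputable def localGram {m d : ℕ} (A : Matrix (MonomialIndex m d) (MonomialIndex m d) ℝ) :
    LocalPoly m :=
  ∑ s, ∑ t, C (A s t) * (monomial s.1 1 * monomial t.1 1)

/-- The tensor product `A 0 ⊗ ⋯ ⊗ A n`. -/
def tensorMatrix {n m d : ℕ}
    (A : Fin (n + 1) → Matrix (MonomialIndex m d) (MonomialIndex m d) ℝ) : GramMatrix n m d :=
  fun a b => ∏ i, A i (a i) (b i)

/-! ### Homogeneity from growth bounds -/

/-- A real polynomial `Q` with `Q(t)² ≤ c t ^ (2 d)` for all `t` is a multiple of `X ^ d`. -/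
theorem Polynomial.coeff_eq_zero_of_sq_eval_le {Q : Polynomial ℝ} {c : ℝ} {d : ℕ}
    (h : ∀ t : ℝ, Q.eval t ^ 2 ≤ c * t ^ (2 * d)) {e : ℕ} (he : e ≠ d) : Q.coeff e = 0 := by
  by_cases hQ : Q = 0
  · simp [hQ]
  rcases lt_or_gt_of_ne he with hlt | hgt
  · -- Dividing by the power of `t` in `Q` and letting `t → 0` bounds that power from below.
    obtain ⟨R, hR, hdvd⟩ := Polynomial.exists_eq_pow_rootMultiplicity_mul_and_not_dvd Q hQ 0
    rw [map_zero, sub_zero] at hR hdvd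
    set r := Q.rootMultiplicity 0
    have hR0 : R.eval 0 ≠ 0 := by
      rwa [Polynomial.X_dvd_iff, Polynomial.coeff_zero_eq_eval_zero] at hdvd
    have hr : d ≤ r := by
      by_contra! hrd
      have key : ∀ᶠ t in nhdsWithin (0 : ℝ) {0}ᶜ, R.eval t ^ 2 ≤ c * t ^ (2 * (d - r)) := by
        filter_upwards [self_mem_nhdsWithin] with t ht
        have ht0 : t ≠ 0 := ht
        have h1 := h t
        rw [hR] at h1
        simp only [Polynomial.eval_mul, Polynomial.eval_pow, Polynomial.eval_X] at h1
        have e1 : c * t ^ (2 * d) = (c * t ^ (2 * (d - r))) * (t ^ r) ^ 2 := by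
          rw [mul_assoc, ← pow_mul, ← pow_add]
          congr 2
          omega
        rw [e1, mul_pow, mul_comm] at h1
        exact le_of_mul_le_mul_right h1 (by positivity)
      have l1 : Filter.Tendsto (fun t => R.eval t ^ 2) (nhdsWithin (0 : ℝ) {0}ᶜ)
          (nhds (R.eval 0 ^ 2)) :=
        ((R.continuous.pow 2).tendsto 0).mono_left nhdsWithin_le_nhds
      have l2 : Filter.Tendsto (fun t : ℝ => c * t ^ (2 * (d - r))) (nhdsWithin (0 : ℝ) {0}ᶜ)
          (nhds (c * 0 ^ (2 * (d - r)))) :=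
        (Continuous.tendsto (by fun_prop) 0).mono_left nhdsWithin_le_nhds
      have l3 := le_of_tendsto_of_tendsto l1 l2 key
      rw [zero_pow (by omega), mul_zero] at l3
      exact hR0 (pow_eq_zero_iff two_ne_zero |>.1 (le_antisymm l3 (sq_nonneg _)))
    rw [hR, Polynomial.coeff_X_pow_mul', if_neg (by omega)]
  · apply Polynomial.coeff_eq_zero_of_natDegree_lt
    by_contra! hle
    have hdeg : (Polynomial.X ^ (2 * d) : Polynomial ℝ).degree < (Q ^ 2).degree := by
      rw [Polynomial.degree_X_pow, Polynomial.degree_eq_natDegree (pow_ne_zero 2 hQ),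
        Polynomial.natDegree_pow]
      exact_mod_cast (by omega : 2 * d < 2 * Q.natDegree)
    have htend := Polynomial.abs_div_tendsto_atTop_atTop_of_degree_gt _ _ hdeg
      (pow_ne_zero _ Polynomial.X_ne_zero)
    obtain ⟨t, h1, h2⟩ :=
      ((htend.eventually_gt_atTop c).and (Filter.eventually_gt_atTop (0 : ℝ))).exists
    simp only [Polynomial.eval_pow, Polynomial.eval_X] at h1
    rw [abs_of_nonneg (by positivity), lt_div_iff₀ (by positivity)] at h1
    exact absurd (h t) (not_le.2 h1)

namespace MvPolynomial

theorem IsHomogeneous.eval_smul {σ R : Type*} [CommSemiring R] {g : MvPolynomial σ R} {d : ℕ}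
    (hg : g.IsHomogeneous d) (t : R) (x : σ → R) : eval (t • x) g = t ^ d * eval x g := by
  rw [eval_eq, eval_eq, Finset.mul_sum]
  refine Finset.sum_congr rfl fun s hs => ?_
  simp only [Pi.smul_apply, smul_eq_mul, mul_pow, Finset.prod_mul_distrib,
    Finset.prod_pow_eq_pow_sum]
  rw [← Finsupp.degree_apply, Finsupp.degree_eq_weight_one]
  have hs' : Finsupp.weight (fun _ : σ => (1 : ℕ)) s = d := hg (mem_support_iff.1 hs)
  rw [hs']
  ring

/-- Along every line through the origin the growth bound leaves only the term of degree `d`. -/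
theorem isHomogeneous_of_sq_eval_smul_le {σ : Type*} {g : MvPolynomial σ ℝ} {d : ℕ}
    (h : ∀ x : σ → ℝ, ∃ c : ℝ, ∀ t : ℝ, eval (t • x) g ^ 2 ≤ c * t ^ (2 * d)) :
    g.IsHomogeneous d := by
  have key : ∀ e, e ≠ d → homogeneousComponent e g = 0 := by
    intro e he
    by_cases hle : e < g.totalDegree + 1
    · refine MvPolynomial.funext fun x => ?_
      obtain ⟨c, hc⟩ := h x
      have hQ : ∀ t : ℝ, (∑ i ∈ Finset.range (g.totalDegree + 1),
          Polynomial.monomial i (eval x (homogeneousComponent i g))).eval t = eval (t • x) g := by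
        intro t
        conv_rhs => rw [← sum_homogeneousComponent g]
        rw [Polynomial.eval_finsetSum, map_sum]
        refine Finset.sum_congr rfl fun i _ => ?_
        rw [Polynomial.eval_monomial, (homogeneousComponent_isHomogeneous i g).eval_smul, mul_comm]
      have := Polynomial.coeff_eq_zero_of_sq_eval_le (Q := ∑ i ∈ Finset.range (g.totalDegree + 1),
          Polynomial.monomial i (eval x (homogeneousComponent i g)))
          (fun t => by rw [hQ]; exact hc t) he
      simpa [Polynomial.finsetSum_coeff, Polynomial.coeff_monomial, hle] using this
    · exact homogeneousComponent_eq_zero _ _ (by omega)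
  rw [← sum_homogeneousComponent g]
  refine IsHomogeneous.sum _ _ _ fun i _ => ?_
  by_cases hi : i = d
  · exact hi ▸ homogeneousComponent_isHomogeneous i g
  · rw [key i hi]
    exact isHomogeneous_zero _ _ _

end MvPolynomial

/-! ### Gram polynomials of one site -/

section LocalGram

open MvPolynomial

variable {m d : ℕ}

theorem isHomogeneous_localGram (A : Matrix (MonomialIndex m d) (MonomialIndex m d) ℝ) :
    (localGram A).IsHomogeneous (2 * d) := by
  have hmono : ∀ s : MonomialIndex m d,
      (monomial s.1 (1 : ℝ) : LocalPoly m).IsHomogeneous d := fun s =>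
    isHomogeneous_monomial 1 (by
      rw [Finsupp.degree_eq_sum]
      exact (Finset.mem_finsuppAntidiag.1 s.2).1)
  refine IsHomogeneous.sum _ _ _ fun s _ => IsHomogeneous.sum _ _ _ fun t _ => ?_
  have := (isHomogeneous_C (Fin (m + 1)) (A s t)).mul ((hmono s).mul (hmono t))
  rwa [zero_add, ← two_mul] at this

theorem localGram_add (A B : Matrix (MonomialIndex m d) (MonomialIndex m d) ℝ) :
    localGram (A + B) = localGram A + localGram B := by
  simp [localGram, add_mul, Finset.sum_add_distrib]

theorem localGram_zero :
    localGram (0 : Matrix (MonomialIndex m d) (MonomialIndex m d) ℝ) = 0 := by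
  simp [localGram]

theorem localGram_sum {ι : Type*} (s : Finset ι)
    (A : ι → Matrix (MonomialIndex m d) (MonomialIndex m d) ℝ) :
    localGram (∑ j ∈ s, A j) = ∑ j ∈ s, localGram (A j) := by
  induction s using Finset.cons_induction with
  | empty => simp [localGram_zero]
  | cons a s ha ih => rw [Finset.sum_cons, Finset.sum_cons, localGram_add, ih]

theorem localGram_vecMulVec (v w : MonomialIndex m d → ℝ) :
    localGram (Matrix.vecMulVec v w) =
      (∑ s, C (v s) * monomial s.1 1) * ∑ s, C (w s) * monomial s.1 1 := by
  rw [Finset.sum_mul_sum]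
  refine Finset.sum_congr rfl fun s _ => Finset.sum_congr rfl fun t _ => ?_
  rw [Matrix.vecMulVec_apply, map_mul C]
  ring

theorem isSumSq_localGram {A : Matrix (MonomialIndex m d) (MonomialIndex m d) ℝ}
    (hA : A.PosSemidef) : IsSumSq (localGram A) := by
  obtain ⟨r, v, rfl⟩ := Matrix.posSemidef_iff_eq_sum_vecMulVec.1 hA
  rw [localGram_sum]
  refine IsSumSq.sum fun j _ => ?_
  rw [localGram_vecMulVec, star_trivial]
  exact IsSumSq.mul_self _

/-- The square of a form of degree `d` is the Gram polynomial of the rank-one matrix given by its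
coefficients. -/
theorem MvPolynomial.IsHomogeneous.mul_self_eq_localGram {g : LocalPoly m}
    (hg : g.IsHomogeneous d) :
    g * g = localGram (Matrix.vecMulVec (fun s : MonomialIndex m d => coeff s.1 g)
      (fun s => coeff s.1 g)) := by
  have h1 : ∑ s : MonomialIndex m d, C (coeff s.1 g) * monomial s.1 1 = g := by
    simp only [C_mul_monomial, mul_one]
    rw [Finset.sum_coe_sort (Finset.finsuppAntidiag Finset.univ d)
      (fun s => monomial s (coeff s g))]
    conv_rhs => rw [← support_sum_monomial_coeff g]
    refine (Finset.sum_subset (fun s hs => ?_) fun s _ hs => ?_).symm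
    · rw [Finset.mem_finsuppAntidiag, ← Finsupp.degree_eq_sum, Finsupp.degree_eq_weight_one]
      exact ⟨hg (mem_support_iff.1 hs), Finset.subset_univ _⟩
    · rw [notMem_support_iff.1 hs, monomial_zero]
  rw [localGram_vecMulVec, h1]

theorem IsSumSq.eval_nonneg {σ : Type*} {f : MvPolynomial σ ℝ} (hf : IsSumSq f) (x : σ → ℝ) :
    0 ≤ eval x f := by
  induction hf with
  | zero => simp
  | sq_add g hs ih =>
    rw [map_add, map_mul]
    exact add_nonneg (mul_self_nonneg _) ih

/-- A growth bound of order `2 d` along all lines forces a sum of squares to be a sum of squares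
of forms of degree `d`, because it holds for each of the squares. -/
theorem IsSumSq.exists_eq_localGram {f : LocalPoly m} (hf : IsSumSq f)
    (h : ∀ x : Fin (m + 1) → ℝ, ∃ c : ℝ, ∀ t : ℝ, eval (t • x) f ≤ c * t ^ (2 * d)) :
    ∃ A : Matrix (MonomialIndex m d) (MonomialIndex m d) ℝ, A.PosSemidef ∧ f = localGram A := by
  induction hf with
  | zero => exact ⟨0, Matrix.PosSemidef.zero, localGram_zero.symm⟩
  | sq_add g hs ih =>
    rename_i s
    obtain ⟨B, hB, rfl⟩ := ih fun x => by
      obtain ⟨c, hc⟩ := h x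
      refine ⟨c, fun t => ?_⟩
      have := hc t
      rw [map_add, map_mul] at this
      nlinarith [mul_self_nonneg (eval (t • x) g)]
    have hg : g.IsHomogeneous d := isHomogeneous_of_sq_eval_smul_le fun x => by
      obtain ⟨c, hc⟩ := h x
      refine ⟨c, fun t => ?_⟩
      have := hc t
      rw [map_add, map_mul] at this
      nlinarith [hs.eval_nonneg (t • x)]
    refine ⟨_ + B, Matrix.PosSemidef.add ?_ hB, by rw [localGram_add, ← hg.mul_self_eq_localGram]⟩
    simpa using Matrix.posSemidef_vecMulVec_self_star (fun s : MonomialIndex m d => coeff s.1 g)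

end LocalGram

/-! ### Tensor products of matrices -/

section TensorMatrix

open MvPolynomial

variable {n m d : ℕ}

theorem gramMap_add (M N : GramMatrix n m d) : gramMap (M + N) = gramMap M + gramMap N := by
  simp [gramMap, add_mul, Finset.sum_add_distrib]

theorem gramMap_smul (c : ℝ) (M : GramMatrix n m d) : gramMap (c • M) = C c * gramMap M := by
  simp [gramMap, Finset.mul_sum, mul_assoc]

theorem gramMap_sum {ι : Type*} (s : Finset ι) (M : ι → GramMatrix n m d) :
    gramMap (∑ j ∈ s, M j) = ∑ j ∈ s, gramMap (M j) := by
  induction s using Finset.cons_induction with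
  | empty => simp [gramMap]
  | cons a s ha ih => rw [Finset.sum_cons, Finset.sum_cons, gramMap_add, ih]

theorem gramMap_tensorMatrix
    (A : Fin (n + 1) → Matrix (MonomialIndex m d) (MonomialIndex m d) ℝ) :
    gramMap (tensorMatrix A) = ∏ i, atSite i (localGram (A i)) := by
  have h1 : ∀ i : Fin (n + 1), (atSite i (localGram (A i)) : GlobalPoly n m) =
      ∑ st : MonomialIndex m d × MonomialIndex m d, C (A i st.1 st.2) *
        (atSite i (monomial st.1.1 1) * atSite i (monomial st.2.1 1)) := by
    intro i
    rw [Fintype.sum_prod_type]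
    simp only [atSite, localGram, map_sum, map_mul, rename_C]
  simp only [h1]
  rw [Finset.prod_univ_sum, Fintype.piFinset_univ,
    ← (Equiv.arrowProdEquivProdArrow _ _ _).symm.sum_comp, Fintype.sum_prod_type]
  refine Finset.sum_congr rfl fun a _ => Finset.sum_congr rfl fun b _ => ?_
  simp only [tensorMatrix, tensorMonomial, Finset.prod_mul_distrib, map_prod]
  rfl

theorem smul_tensorMatrix (c : Fin (n + 1) → ℝ)
    (A : Fin (n + 1) → Matrix (MonomialIndex m d) (MonomialIndex m d) ℝ) :
    tensorMatrix (fun i => c i • A i) = (∏ i, c i) • tensorMatrix A := by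
  ext a b
  simp [tensorMatrix, Finset.prod_mul_distrib]

theorem trace_tensorMatrix
    (A : Fin (n + 1) → Matrix (MonomialIndex m d) (MonomialIndex m d) ℝ) :
    (tensorMatrix A).trace = ∏ i, (A i).trace := by
  simp only [Matrix.trace, Matrix.diag]
  rw [Finset.prod_univ_sum, Fintype.piFinset_univ]
  rfl

theorem isSeparableMatrix_sum_tensorMatrix {ι : Type*} [Fintype ι]
    (A : ι → Fin (n + 1) → Matrix (MonomialIndex m d) (MonomialIndex m d) ℝ)
    (hA : ∀ j i, (A j i).PosSemidef) : IsSeparableMatrix (∑ j, tensorMatrix (A j)) := by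
  refine ⟨Fintype.card ι, fun l i => A ((Fintype.equivFin ι).symm l) i, fun l i => hA _ _,
    fun a b => ?_⟩
  rw [Matrix.sum_apply, ← Equiv.sum_comp (Fintype.equivFin ι).symm]
  rfl

/-- The definition of separability, with the tensor products as matrices. -/
theorem IsSeparableMatrix.exists_eq_sum {M : GramMatrix n m d} (hM : IsSeparableMatrix M) :
    ∃ (r : ℕ) (A : Fin r → Fin (n + 1) → Matrix (MonomialIndex m d) (MonomialIndex m d) ℝ),
      (∀ j i, (A j i).PosSemidef) ∧ M = ∑ j, tensorMatrix (A j) := by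
  obtain ⟨r, A, hA, h⟩ := hM
  refine ⟨r, A, hA, ?_⟩
  ext a b
  rw [h, Matrix.sum_apply]
  rfl

/-- A scalar can be absorbed into the factor of the first site. -/
theorem tensorMatrix_smul_first (c : ℝ)
    (A : Fin (n + 1) → Matrix (MonomialIndex m d) (MonomialIndex m d) ℝ) :
    tensorMatrix (fun i => (if i = 0 then c else 1) • A i) = c • tensorMatrix A := by
  rw [smul_tensorMatrix, Finset.prod_ite_eq' _ _ _, if_pos (Finset.mem_univ _)]

theorem Matrix.PosSemidef.ite_smul {ι κ : Type*} {A : Matrix ι ι ℝ} (hA : A.PosSemidef)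
    {c : ℝ} (hc : 0 ≤ c) (i j : κ) [Decidable (i = j)] :
    ((if i = j then c else 1) • A).PosSemidef :=
  hA.smul (by split_ifs; exacts [hc, zero_le_one])

end TensorMatrix

/-! ### Multi-homogeneous separable polynomials -/

section MultiHomogeneous

open MvPolynomial

variable {n m : ℕ}

/-- Multi-homogeneity is homogeneity for each of the gradings by the degree at one site. -/
theorem isMultiHomogeneous_iff {e : ℕ} {p : GlobalPoly n m} :
    IsMultiHomogeneous e p ↔
      ∀ i : Fin (n + 1), IsWeightedHomogeneous (fun v => if v.1 = i then 1 else 0) p e := by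
  have h : ∀ (i : Fin (n + 1)) (s : Fin (n + 1) × Fin (m + 1) →₀ ℕ),
      Finsupp.weight (fun v : Fin (n + 1) × Fin (m + 1) => if v.1 = i then 1 else 0) s =
        ∑ k, s (i, k) := by
    intro i s
    rw [Finsupp.weight_apply, Finsupp.sum_fintype _ _ (by simp), Fintype.sum_prod_type,
      Finset.sum_eq_single i (by intro j _ hj; simp [hj]) (by simp)]
    simp
  constructor
  · intro hp i s hs
    rw [h]
    exact hp s (mem_support_iff.2 hs) i
  · intro hp s hs i
    rw [← h]
    exact hp i (mem_support_iff.1 hs)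

theorem isWeightedHomogeneous_atSite {e : ℕ} {f : LocalPoly m} (hf : f.IsHomogeneous e)
    (i j : Fin (n + 1)) :
    IsWeightedHomogeneous (fun v => if v.1 = i then 1 else 0) (atSite j f : GlobalPoly n m)
      (if j = i then e else 0) := by
  intro s hs
  obtain ⟨u, rfl, hu⟩ := coeff_rename_ne_zero _ _ _ hs
  have h1 : Finsupp.weight (fun _ : Fin (m + 1) => (1 : ℕ)) u = e := hf hu
  rw [Finsupp.weight_apply] at h1 ⊢
  rw [Finsupp.sum_mapDomain_index (by simp) (by intros; rw [add_smul])]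
  split_ifs
  · simpa using h1
  · simp

theorem isMultiHomogeneous_prod_atSite {e : ℕ} {f : Fin (n + 1) → LocalPoly m}
    (hf : ∀ i, (f i).IsHomogeneous e) : IsMultiHomogeneous e (∏ i, atSite i (f i)) := by
  refine isMultiHomogeneous_iff.2 fun i => ?_
  have := IsWeightedHomogeneous.prod Finset.univ (fun j => (atSite j (f j) : GlobalPoly n m)) _
    (fun j _ => isWeightedHomogeneous_atSite (hf j) i j)
  simpa using this

theorem IsMultiHomogeneous.sum {e : ℕ} {ι : Type*} (s : Finset ι) (p : ι → GlobalPoly n m)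
    (hp : ∀ j ∈ s, IsMultiHomogeneous e (p j)) : IsMultiHomogeneous e (∑ j ∈ s, p j) :=
  isMultiHomogeneous_iff.2 fun i => IsWeightedHomogeneous.sum _ _ _ fun j hj =>
    isMultiHomogeneous_iff.1 (hp j hj) i

/-- Scaling the variables of one site scales a multi-homogeneous polynomial. -/
theorem IsMultiHomogeneous.eval_smul_site {e : ℕ} {p : GlobalPoly n m}
    (hp : IsMultiHomogeneous e p) (i : Fin (n + 1)) (t : ℝ) (y : Fin (n + 1) → Fin (m + 1) → ℝ) :
    eval (fun v => Function.update y i (t • y i) v.1 v.2) p =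
      t ^ e * eval (fun v => y v.1 v.2) p := by
  rw [eval_eq', eval_eq', Finset.mul_sum]
  refine Finset.sum_congr rfl fun s hs => ?_
  have h1 : ∀ v : Fin (n + 1) × Fin (m + 1), Function.update y i (t • y i) v.1 v.2 ^ s v =
      (if v.1 = i then t ^ s v else 1) * y v.1 v.2 ^ s v := by
    intro v
    by_cases hv : v.1 = i
    · subst hv
      simp [mul_pow]
    · simp [hv]
  have h2 : ∏ v : Fin (n + 1) × Fin (m + 1), (if v.1 = i then t ^ s v else 1) = t ^ e := by
    rw [Fintype.prod_prod_type, Finset.prod_eq_single i (by intro j _ hj; simp [hj]) (by simp)]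
    simp only [if_true, Finset.prod_pow_eq_pow_sum]
    rw [hp s hs i]
  simp only [h1, Finset.prod_mul_distrib, h2]
  ring

theorem eval_atSite (i : Fin (n + 1)) (f : LocalPoly m) (y : Fin (n + 1) → Fin (m + 1) → ℝ) :
    eval (fun v => y v.1 v.2) (atSite i f) = eval (y i) f := by
  rw [atSite, eval_rename]
  rfl

theorem eval_prod_atSite (f : Fin (n + 1) → LocalPoly m) (y : Fin (n + 1) → Fin (m + 1) → ℝ) :
    eval (fun v => y v.1 v.2) (∏ i, atSite i (f i)) = ∏ i, eval (y i) (f i) := by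
  simp only [map_prod, eval_atSite]

/-- The local factors of a separable representation of a multi-homogeneous polynomial can be
chosen as Gram polynomials: each summand is dominated by `p`, so each of its factors grows at most
like `t ^ (2 * d)` along lines, as long as no other factor vanishes identically. -/
theorem IsSeparablePoly.exists_localGram {d : ℕ} {p : GlobalPoly n m} (hsep : IsSeparablePoly p)
    (hhom : IsMultiHomogeneous (2 * d) p) :
    ∃ (r : ℕ) (A : Fin r → Fin (n + 1) → Matrix (MonomialIndex m d) (MonomialIndex m d) ℝ),
      (∀ j i, (A j i).PosSemidef) ∧ p = ∑ j, ∏ i, atSite i (localGram (A j i)) := by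
  obtain ⟨r, f, hf, hp⟩ := hsep
  have key : ∀ j, ∃ A : Fin (n + 1) → Matrix (MonomialIndex m d) (MonomialIndex m d) ℝ,
      (∀ i, (A i).PosSemidef) ∧
      (∏ i, atSite i (f j i) : GlobalPoly n m) = ∏ i, atSite i (localGram (A i)) := by
    intro j
    by_cases h0 : ∃ i, f j i = 0
    · obtain ⟨i, hi⟩ := h0
      refine ⟨fun _ => 0, fun _ => Matrix.PosSemidef.zero, ?_⟩
      rw [Finset.prod_eq_zero (Finset.mem_univ i) (by rw [hi, atSite, map_zero]),
        Finset.prod_eq_zero (Finset.mem_univ i) (by rw [localGram_zero, atSite, map_zero])]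
    push Not at h0
    have hpt : ∀ i, ∃ x : Fin (m + 1) → ℝ, 0 < eval x (f j i) := by
      intro i
      by_contra! hx
      exact h0 i (MvPolynomial.funext fun x => by
        rw [map_zero]
        exact le_antisymm (hx x) ((hf j i).eval_nonneg x))
    choose y hy using hpt
    have hle : ∀ w : Fin (n + 1) → Fin (m + 1) → ℝ,
        ∏ i, eval (w i) (f j i) ≤ eval (fun v => w v.1 v.2) p := by
      intro w
      simp only [hp, map_sum, eval_prod_atSite]
      exact Finset.single_le_sum (f := fun j => ∏ i, eval (w i) (f j i))
        (fun j' _ => Finset.prod_nonneg fun i _ => (hf j' i).eval_nonneg _) (Finset.mem_univ j)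
    have hA : ∀ i, ∃ A : Matrix (MonomialIndex m d) (MonomialIndex m d) ℝ,
        A.PosSemidef ∧ f j i = localGram A := by
      intro i
      -- The other sites stay at the points `y`, where their factors have the positive product `c`.
      refine (hf j i).exists_eq_localGram fun x => ?_
      set c := ∏ i' ∈ Finset.univ.erase i, eval (y i') (f j i')
      have hc : 0 < c := Finset.prod_pos fun i' _ => hy i'
      set z := Function.update y i x
      refine ⟨eval (fun v => z v.1 v.2) p / c, fun t => ?_⟩
      rw [div_mul_eq_mul_div, le_div_iff₀ hc, mul_comm (eval _ p), ← hhom.eval_smul_site i t z]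
      have hz : Function.update z i (t • z i) = Function.update y i (t • x) := by
        simp [z]
      rw [hz]
      set w := Function.update y i (t • x)
      refine le_trans (le_of_eq ?_) (hle w)
      rw [← Finset.mul_prod_erase _ _ (Finset.mem_univ i)]
      congr 1
      · simp only [w, Function.update_self]
      · refine Finset.prod_congr rfl fun i' hi' => ?_
        simp only [w, Function.update_of_ne (Finset.ne_of_mem_erase hi')]
    choose A hA1 hA2 using hA
    exact ⟨A, hA1, by simp only [← hA2]⟩
  choose A hA1 hA2 using key
  exact ⟨r, A, hA1, by rw [hp]; exact Finset.sum_congr rfl fun j _ => hA2 j⟩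

end MultiHomogeneous

/-! ### Invariant Gram matrices -/

section Nonempty

open MvPolynomial

variable {n m d : ℕ}

theorem rename_smul_prod_atSite {G : Type*} [Group G] [MulAction G (Fin (n + 1))] (g : G)
    (f : Fin (n + 1) → LocalPoly m) :
    rename (fun v : Fin (n + 1) × Fin (m + 1) => (g • v.1, v.2)) (∏ i, atSite i (f i)) =
      (∏ i, atSite i (f (g⁻¹ • i)) : GlobalPoly n m) := by
  rw [map_prod, ← Equiv.prod_comp (MulAction.toPerm g) fun i => atSite i (f (g⁻¹ • i))]
  refine Finset.prod_congr rfl fun i _ => ?_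
  simp only [MulAction.toPerm_apply, inv_smul_smul, atSite, rename_rename]
  rfl

/-- The matrix in question is the average over `G` of the Gram matrix given by
`IsSeparablePoly.exists_localGram`, divided by one plus its trace. -/
theorem gramScalings_nonempty {G : Type*} [Group G] [Finite G] [MulAction G (Fin (n + 1))]
    {p : GlobalPoly n m} (hhom : IsMultiHomogeneous (2 * d) p) (hsep : IsSeparablePoly p)
    (hinv : IsInvariantPoly G p) : (gramScalings G d p).Nonempty := by
  cases nonempty_fintype G
  obtain ⟨r, A, hA, hp⟩ := hsep.exists_localGram hhom
  set T := ∑ j, ∏ i, (A j i).trace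
  have hT : 0 ≤ T := Finset.sum_nonneg fun j _ => Finset.prod_nonneg fun i _ =>
    (hA j i).trace_nonneg
  set c : ℝ := ((T + 1) * Fintype.card G)⁻¹
  have hG : (0 : ℝ) < Fintype.card G := by exact_mod_cast Fintype.card_pos
  have hc : 0 < c := inv_pos.2 (mul_pos (by linarith) hG)
  set B : Fin r × G → Fin (n + 1) → Matrix (MonomialIndex m d) (MonomialIndex m d) ℝ :=
    fun jg i => A jg.1 (jg.2⁻¹ • i)
  have hB : ∀ jg : Fin r × G, (∏ i, (B jg i).trace) = ∏ i, (A jg.1 i).trace := fun jg =>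
    Equiv.prod_comp (MulAction.toPerm jg.2⁻¹) fun i => (A jg.1 i).trace
  set M : GramMatrix n m d := ∑ jg, tensorMatrix fun i => (if i = 0 then c else 1) • B jg i
  have hM : M = c • ∑ jg, tensorMatrix (B jg) := by
    simp only [M, tensorMatrix_smul_first, Finset.smul_sum]
  refine ⟨T + 1, by linarith, M, ?_, ?_, ?_, ?_⟩
  · exact isSeparableMatrix_sum_tensorMatrix _ fun jg i => (hA _ _).ite_smul hc.le _ _
  · rw [hM, Matrix.trace_smul, Matrix.trace_sum]
    simp only [trace_tensorMatrix, hB]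
    rw [Fintype.sum_prod_type]
    simp only [Finset.sum_const, Finset.card_univ, nsmul_eq_mul, ← Finset.mul_sum, smul_eq_mul]
    rw [inv_mul_le_iff₀ (by positivity)]
    nlinarith
  · intro g a b
    rw [hM]
    simp only [Matrix.smul_apply, Matrix.sum_apply, tensorMatrix, B]
    congr 1
    refine Fintype.sum_equiv ((Equiv.refl (Fin r)).prodCongr (Equiv.mulLeft g)) _ _ fun jg =>
      Fintype.prod_equiv (MulAction.toPerm g) _ _ fun i => ?_
    simp [mul_smul]
  · have h1 : gramMap (∑ jg, tensorMatrix (B jg)) = C (Fintype.card G : ℝ) * p := by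
      have h2 : ∀ g : G, ∑ j, gramMap (tensorMatrix (B (j, g))) = p := by
        intro g
        conv_rhs => rw [← hinv g, hp, map_sum]
        refine Finset.sum_congr rfl fun j _ => ?_
        rw [rename_smul_prod_atSite, gramMap_tensorMatrix]
      rw [gramMap_sum, Fintype.sum_prod_type, Finset.sum_comm]
      simp only [h2, Finset.sum_const, Finset.card_univ, nsmul_eq_mul, map_natCast]
    have h3 : (T + 1) * (c * Fintype.card G) = 1 := by
      simp only [c]
      field_simp
    rw [hM, gramMap_smul, h1, ← mul_assoc, ← mul_assoc, ← C_mul, ← C_mul, mul_assoc, h3, C_1,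
      one_mul]

end Nonempty

/-! ### Approximate Carathéodory theorem -/

section ApproximateCaratheodory

/-- Approximate Carathéodory theorem in an inner product space: a point `X` of the convex hull of a
subset `s` of the unit ball is within `2 / √k` of the mean of `k` points of `s`. The points are
chosen greedily: there is always a next one whose deviation from `X` makes an obtuse angle with
the sum of the previous deviations. -/
theorem exists_norm_sq_sum_sub_le_of_mem_convexHull {E : Type*} [NormedAddCommGroup E]
    [InnerProductSpace ℝ E] {s : Set E} (hs : ∀ x ∈ s, ‖x‖ ≤ 1) {X : E}
    (hX : X ∈ convexHull ℝ s) (k : ℕ) :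
    ∃ x : Fin k → E, (∀ j, x j ∈ s) ∧ ‖∑ j, (x j - X)‖ ^ 2 ≤ 4 * k := by
  have hX1 : ‖X‖ ≤ 1 := by
    have := convexHull_min (t := Metric.closedBall (0 : E) 1) (fun x hx => by simpa using hs x hx)
      (convex_closedBall _ _) hX
    simpa using this
  have hnext : ∀ S : E, ∃ x ∈ s, inner ℝ S (x - X) ≤ 0 := by
    intro S
    by_contra! h
    have hconv : Convex ℝ {y : E | inner ℝ S X < inner ℝ S y} :=
      convex_halfSpace_gt (innerₛₗ ℝ S).isLinear _
    have := convexHull_min (fun x hx => by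
      have := h x hx
      rw [inner_sub_right] at this
      exact sub_pos.1 this) hconv hX
    exact lt_irrefl (inner ℝ S X) this
  induction k with
  | zero => exact ⟨Fin.elim0, fun j => j.elim0, by simp⟩
  | succ k ih =>
    obtain ⟨x, hxs, hx⟩ := ih
    obtain ⟨y, hys, hy⟩ := hnext (∑ j, (x j - X))
    refine ⟨Fin.snoc x y, fun j => ?_, ?_⟩
    · refine Fin.lastCases ?_ (fun j => ?_) j
      · simpa using hys
      · simpa using hxs j
    · have hyX : ‖y - X‖ ≤ 2 := (norm_sub_le _ _).trans (by linarith [hs y hys])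
      simp only [Fin.sum_univ_castSucc, Fin.snoc_castSucc, Fin.snoc_last]
      rw [norm_add_sq_real]
      push_cast
      nlinarith [norm_nonneg (y - X)]

end ApproximateCaratheodory

/-! ### The Hilbert-Schmidt norm of Gram matrices -/

section HilbertSchmidt

open MvPolynomial

variable {n m d : ℕ}

/-- The Hilbert-Schmidt norm of a positive semidefinite matrix is at most its trace, because
`A a b ^ 2 ≤ A a a * A b b`. -/
theorem Matrix.PosSemidef.sum_sq_le_trace_sq {ι : Type*} [Fintype ι] {A : Matrix ι ι ℝ}
    (hA : A.PosSemidef) : ∑ a, ∑ b, A a b ^ 2 ≤ A.trace ^ 2 := by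
  obtain ⟨r, v, hv⟩ := Matrix.posSemidef_iff_eq_sum_vecMulVec.1 hA
  have hentry : ∀ a b, A a b = ∑ j, v j a * v j b := fun a b => by
    simp [hv, Matrix.sum_apply, Matrix.vecMulVec_apply]
  calc ∑ a, ∑ b, A a b ^ 2 ≤ ∑ a, ∑ b, A a a * A b b := by
        refine Finset.sum_le_sum fun a _ => Finset.sum_le_sum fun b _ => ?_
        have := Finset.sum_mul_sq_le_sq_mul_sq Finset.univ (fun j => v j a) fun j => v j b
        simpa only [hentry, sq] using this
    _ = A.trace ^ 2 := by
        rw [sq, Matrix.trace, Finset.sum_mul_sum]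
        rfl

/-- The entries of a matrix as a vector, so that the Euclidean norm is the Hilbert-Schmidt norm. -/
noncomputable def entries (M : GramMatrix n m d) :
    EuclideanSpace ℝ ((Fin (n + 1) → MonomialIndex m d) × (Fin (n + 1) → MonomialIndex m d)) :=
  WithLp.toLp 2 fun ab => M ab.1 ab.2

/-- The Hilbert-Schmidt norm and the trace are both multiplicative on tensor products. -/
theorem norm_entries_tensorMatrix_le
    {A : Fin (n + 1) → Matrix (MonomialIndex m d) (MonomialIndex m d) ℝ}
    (hA : ∀ i, (A i).PosSemidef) : ‖entries (tensorMatrix A)‖ ≤ ∏ i, (A i).trace := by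
  refine le_of_sq_le_sq ?_ (Finset.prod_nonneg fun i _ => (hA i).trace_nonneg)
  rw [EuclideanSpace.norm_sq_eq, ← Finset.prod_pow]
  have h1 : ∑ ab, ‖entries (tensorMatrix A) ab‖ ^ 2 = ∏ i, ∑ s, ∑ t, A i s t ^ 2 := by
    simp only [← Fintype.sum_prod_type']
    rw [Finset.prod_univ_sum, Fintype.piFinset_univ,
      ← (Equiv.arrowProdEquivProdArrow _ _ _).symm.sum_comp]
    refine Finset.sum_congr rfl fun ab _ => ?_
    rw [Real.norm_eq_abs, sq_abs, Finset.prod_pow]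
    rfl
  rw [h1]
  exact Finset.prod_le_prod (fun i _ => by positivity) fun i _ => (hA i).sum_sq_le_trace_sq

/-- On the unit sphere the vector of monomials of degree `d` has norm at most `1`, by the
multinomial theorem. -/
theorem sum_prod_pow_sq_le_one {x : EuclideanSpace ℝ (Fin (m + 1))} (hx : ‖x‖ = 1) :
    ∑ s : MonomialIndex m d, (∏ k, x k ^ s.1 k) ^ 2 ≤ 1 := by
  have h1 : ∑ k, x k ^ 2 = 1 := by
    have := EuclideanSpace.norm_sq_eq x
    simpa [hx] using this.symm
  rw [Finset.sum_coe_sort (Finset.finsuppAntidiag Finset.univ d)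
    (fun s : Fin (m + 1) →₀ ℕ => (∏ k, x k ^ s k) ^ 2)]
  calc _ = ∑ s ∈ Finset.piAntidiag Finset.univ d, ∏ k, (x k ^ 2) ^ s k := by
        refine Finset.sum_bij (fun s _ => s) (fun s hs => ?_)
          (fun _ _ _ _ h => DFunLike.coe_injective h)
          (fun f hf => ⟨Finsupp.equivFunOnFinite.symm f, ?_, rfl⟩) fun s _ => ?_
        · simpa using hs
        · simpa using hf
        · rw [← Finset.prod_pow]
          exact Finset.prod_congr rfl fun k _ => by ring
    _ ≤ ∑ s ∈ Finset.piAntidiag Finset.univ d,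
          (Nat.multinomial Finset.univ s : ℝ) * ∏ k, (x k ^ 2) ^ s k := by
        refine Finset.sum_le_sum fun s _ => le_mul_of_one_le_left (by positivity) ?_
        exact_mod_cast Nat.multinomial_pos _ _
    _ = 1 := by rw [← Finset.sum_pow_eq_sum_piAntidiag, h1, one_pow]

/-- On the product of the unit spheres the Gram map is bounded by the Hilbert-Schmidt norm. -/
theorem abs_eval_gramMap_le (M : GramMatrix n m d)
    (x : Fin (n + 1) → Metric.sphere (0 : EuclideanSpace ℝ (Fin (m + 1))) 1) :
    |eval (fun v => (x v.1).1 v.2) (gramMap M)| ≤ ‖entries M‖ := by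
  set u : (Fin (n + 1) → MonomialIndex m d) → ℝ := fun a => ∏ i, ∏ k, (x i).1 k ^ (a i).1 k
  have hu : ∑ a, u a ^ 2 ≤ 1 := by
    have h1 : ∑ a, u a ^ 2 = ∏ i, ∑ s : MonomialIndex m d, (∏ k, (x i).1 k ^ s.1 k) ^ 2 := by
      rw [Finset.prod_univ_sum, Fintype.piFinset_univ]
      simp only [u, Finset.prod_pow]
    rw [h1]
    exact Finset.prod_le_one (fun i _ => by positivity) fun i _ =>
      sum_prod_pow_sq_le_one (by simp)
  have hmono : ∀ a, eval (fun v => (x v.1).1 v.2) (tensorMonomial a : GlobalPoly n m) = u a := by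
    intro a
    rw [tensorMonomial, eval_prod_atSite (y := fun i k => (x i).1 k)]
    simp only [eval_monomial, one_mul, u]
    simp only [Finsupp.prod_fintype, pow_zero, implies_true]
  have hval : eval (fun v => (x v.1).1 v.2) (gramMap M) =
      ∑ ab : (Fin (n + 1) → MonomialIndex m d) × (Fin (n + 1) → MonomialIndex m d),
        M ab.1 ab.2 * (u ab.1 * u ab.2) := by
    rw [Fintype.sum_prod_type]
    simp only [gramMap, map_sum, map_mul, eval_C, hmono]
  have huu : ∑ ab : (Fin (n + 1) → MonomialIndex m d) × (Fin (n + 1) → MonomialIndex m d),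
      (u ab.1 * u ab.2) ^ 2 = (∑ a, u a ^ 2) ^ 2 := by
    rw [Fintype.sum_prod_type, sq (∑ a, _), Finset.sum_mul_sum]
    simp only [mul_pow]
  refine abs_le_of_sq_le_sq ?_ (norm_nonneg _)
  rw [hval]
  refine (Finset.sum_mul_sq_le_sq_mul_sq _ _ _).trans ?_
  rw [huu, EuclideanSpace.norm_sq_eq]
  have h0 : 0 ≤ ∑ a, u a ^ 2 := by positivity
  simp only [Real.norm_eq_abs, sq_abs]
  exact mul_le_of_le_one_right (by positivity) (by nlinarith)

/-- The tensor products `A 0 ⊗ ⋯ ⊗ A n` of positive semidefinite matrices with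
`tr (A 0 ⊗ ⋯ ⊗ A n) ≤ 1`, as vectors of entries. -/
def productStates (n m d : ℕ) : Set
    (EuclideanSpace ℝ ((Fin (n + 1) → MonomialIndex m d) × (Fin (n + 1) → MonomialIndex m d))) :=
  {x | ∃ A : Fin (n + 1) → Matrix (MonomialIndex m d) (MonomialIndex m d) ℝ,
    (∀ i, (A i).PosSemidef) ∧ ∏ i, (A i).trace ≤ 1 ∧ x = entries (tensorMatrix A)}

theorem norm_le_one_of_mem_productStates : ∀ x ∈ productStates n m d, ‖x‖ ≤ 1 := by
  rintro _ ⟨A, hA, htr, rfl⟩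
  exact (norm_entries_tensorMatrix_le hA).trans htr

theorem zero_mem_productStates : 0 ∈ productStates n m d := by
  refine ⟨fun _ => 0, fun _ => Matrix.PosSemidef.zero, by simp, ?_⟩
  ext ab
  simp [entries, tensorMatrix]

theorem entries_smul (c : ℝ) (M : GramMatrix n m d) : entries (c • M) = c • entries M := rfl

theorem entries_sum {ι : Type*} (s : Finset ι) (M : ι → GramMatrix n m d) :
    entries (∑ j ∈ s, M j) = ∑ j ∈ s, entries (M j) := by
  ext ab
  simp [entries, Matrix.sum_apply]

/-- The weight of each tensor product is its trace; a product of trace zero vanishes. -/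
theorem IsSeparableMatrix.entries_mem_convexHull {M : GramMatrix n m d} (hM : IsSeparableMatrix M)
    (htr : M.trace ≤ 1) : entries M ∈ convexHull ℝ (productStates n m d) := by
  obtain ⟨r, A, hA, rfl⟩ := hM.exists_eq_sum
  set w : Fin r → ℝ := fun j => ∏ i, (A j i).trace
  have hw : ∀ j, 0 ≤ w j := fun j => Finset.prod_nonneg fun i _ => (hA j i).trace_nonneg
  have hsum : ∑ j, w j ≤ 1 := by
    simpa only [Matrix.trace_sum, trace_tensorMatrix] using htr
  set y := fun j => (w j)⁻¹ • entries (tensorMatrix (A j))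
  have hy : ∀ j, y j ∈ productStates n m d := by
    intro j
    refine ⟨fun i => (if i = 0 then (w j)⁻¹ else 1) • A j i,
      fun i => (hA j i).ite_smul (inv_nonneg.2 (hw j)) _ _, ?_, ?_⟩
    · rw [← trace_tensorMatrix, tensorMatrix_smul_first, Matrix.trace_smul, trace_tensorMatrix]
      exact inv_mul_le_one
    · rw [tensorMatrix_smul_first, entries_smul]
  have hwy : ∀ j, w j • y j = entries (tensorMatrix (A j)) := by
    intro j
    by_cases h0 : w j = 0
    · have := norm_entries_tensorMatrix_le (hA j)
      rw [show ∏ i, (A j i).trace = 0 from h0] at this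
      rw [h0, zero_smul, norm_le_zero_iff.1 this]
    · exact smul_inv_smul₀ h0 _
  rw [entries_sum]
  simp only [← hwy]
  -- The missing weight `1 - ∑ j, w j` is given to the zero vector.
  have h1 := (convex_convexHull ℝ (productStates n m d)).sum_mem (t := Finset.univ)
    (w := fun o : Option (Fin r) => o.elim (1 - ∑ j, w j) w) (z := fun o => o.elim 0 y) ?_ ?_ ?_
  · simpa [Fintype.sum_option] using h1
  · rintro (_ | j) _
    · simpa using hsum
    · exact hw j
  · simp [Fintype.sum_option]
  · rintro (_ | j) _
    · exact subset_convexHull ℝ _ zero_mem_productStates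
    · exact subset_convexHull ℝ _ (hy j)

end HilbertSchmidt

/-! ### Coherent labellings of multifacets -/

namespace WeightedSimplicialComplex

variable {n : ℕ} {Ω : WeightedSimplicialComplex n}

theorem exists_multiFacet_mem (Ω : WeightedSimplicialComplex n) {F : Finset (Fin (n + 1))}
    (hF : Ω.IsFacet F) : ∃ f : Ω.MultiFacet, collapse f = F :=
  ⟨⟨⟨F, hF⟩, ⟨0, Nat.pos_of_ne_zero hF.prop⟩⟩, rfl⟩

theorem nonempty_multiFacetAt (Ω : WeightedSimplicialComplex n) (i : Fin (n + 1)) :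
    Nonempty (Ω.MultiFacetAt i) := by
  obtain ⟨F, hle, hF⟩ := (Set.toFinite {S | Ω.IsSimplex S}).exists_le_maximal
    (Ω.weight_singleton i)
  obtain ⟨f, hf⟩ := Ω.exists_multiFacet_mem hF
  exact ⟨⟨f, hf ▸ Finset.singleton_subset_iff.1 hle⟩⟩

theorem collapse_nonempty (f : Ω.MultiFacet) : (collapse f).Nonempty := by
  rw [Finset.nonempty_iff_ne_empty]
  intro h
  have := f.1.2.le_of_ge (Ω.weight_singleton 0) (h.le.trans (Finset.empty_subset _))
  exact absurd (this (Finset.mem_singleton_self 0)) (by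
    rw [show (f.1.1 : Finset _) = ∅ from h]
    exact Finset.notMem_empty _)

/-- A free action admits an equivariant map to the group, given by a choice of orbit
representatives. -/
theorem IsFreeAction.exists_equivariant {G : Type*} [Group G] [MulAction G Ω.MultiFacet]
    (hfree : Ω.IsFreeAction G) :
    ∃ φ : Ω.MultiFacet → G, ∀ (g : G) (f : Ω.MultiFacet), φ (g • f) = g * φ f := by
  let rep : Ω.MultiFacet → Ω.MultiFacet := fun f =>
    (Quotient.mk (MulAction.orbitRel G Ω.MultiFacet) f).out
  have hrep : ∀ f, ∃ g : G, g • rep f = f := fun f =>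
    (MulAction.orbitRel G Ω.MultiFacet).symm (Quotient.mk_out (s := MulAction.orbitRel G _) f)
  choose φ hφ using hrep
  refine ⟨φ, fun g f => ?_⟩
  have hsame : rep (g • f) = rep f := by
    simp only [rep]
    congr 1
    exact Quotient.sound ⟨g, rfl⟩
  have h1 := hφ (g • f)
  rw [hsame] at h1
  have h2 : ((g * φ f)⁻¹ * φ (g • f)) • rep f = rep f := by
    rw [mul_smul, h1, mul_inv_rev, mul_smul, inv_smul_smul, inv_smul_eq_iff, hφ]
  exact (inv_mul_eq_one.1 (hfree _ _ h2)).symm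

variable {G : Type*} [Group G]

/-- A labelling `β` of multifacets by pairs is coherent with `(j, h)` if it is the restriction of
the labelling `f ↦ (j, (φ f)⁻¹ h)`, where `φ` is an equivariant map to the group. -/
def Coherent {J : Type*} (φ : Ω.MultiFacet → G) (i : Fin (n + 1))
    (β : Ω.MultiFacetAt i → J × G) (jh : J × G) : Prop :=
  ∀ f, β f = (jh.1, (φ f.1)⁻¹ * jh.2)

variable {J : Type*} {φ : Ω.MultiFacet → G}

theorem eq_of_labels_eq (f : Ω.MultiFacet) {jh jh' : J × G}
    (h : (jh.1, (φ f)⁻¹ * jh.2) = (jh'.1, (φ f)⁻¹ * jh'.2)) : jh = jh' := by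
  rw [Prod.mk.injEq] at h
  exact Prod.ext h.1 (mul_left_cancel h.2)

theorem Coherent.eq {i : Fin (n + 1)} {β : Ω.MultiFacetAt i → J × G} {jh jh' : J × G}
    (h : Coherent φ i β jh) (h' : Coherent φ i β jh') : jh = jh' := by
  obtain ⟨f⟩ := Ω.nonempty_multiFacetAt i
  exact eq_of_labels_eq f.1 ((h f).symm.trans (h' f))

theorem coherent_translate_iff [MulAction G (Fin (n + 1))] [MulAction G Ω.MultiFacet]
    (hΩ : Ω.IsGroupAction G)
    (hφ : ∀ (g : G) (f : Ω.MultiFacet), φ (g • f) = g * φ f) {i : Fin (n + 1)} (g : G)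
    (β : Ω.MultiFacetAt i → J × G) (jh : J × G) :
    Coherent φ (g • i) (translate hΩ g β) (jh.1, g * jh.2) ↔ Coherent φ i β jh := by
  constructor
  · intro h f
    have hmem : g • i ∈ collapse (g • f.1) := by
      rw [hΩ.collapse_smul]
      exact Finset.mem_image_of_mem _ f.2
    have h1 := h ⟨g • f.1, hmem⟩
    simp only [translate, inv_smul_smul, hφ] at h1
    refine h1.trans ?_
    simp [mul_assoc]
  · intro h f
    refine (h ⟨g⁻¹ • f.1, hΩ.mem_collapse_inv_smul g f.2⟩).trans ?_
    simp [hφ, mul_assoc]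

/-- On a connected complex, local coherence at all vertices is global coherence: neighbouring
vertices share a multifacet, whose label determines the pair. -/
theorem exists_forall_eq_of_coherent (hconn : Ω.IsConnected) {α : Ω.MultiFacet → J × G}
    (h : ∀ i, ∃ jh, Coherent φ i (restrict α i) jh) :
    ∃ jh : J × G, ∀ f, α f = (jh.1, (φ f)⁻¹ * jh.2) := by
  choose jh hjh using h
  have hstep : ∀ i j, Ω.Neighbours i j → jh i = jh j := by
    rintro i j ⟨F, hF, hi, hj⟩
    obtain ⟨f, rfl⟩ := Ω.exists_multiFacet_mem hF
    exact eq_of_labels_eq f ((hjh i ⟨f, hi⟩).symm.trans (hjh j ⟨f, hj⟩))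
  have hconst : ∀ i, jh 0 = jh i := by
    intro i
    induction hconn 0 i with
    | refl => rfl
    | tail _ hbc ih => exact ih.trans (hstep _ _ hbc)
  refine ⟨jh 0, fun f => ?_⟩
  obtain ⟨i, hi⟩ := collapse_nonempty f
  rw [hconst i]
  exact hjh i ⟨f, hi⟩

end WeightedSimplicialComplex

/-! ### The rank of orbit sums -/

section Rank

open WeightedSimplicialComplex MvPolynomial

variable {n m : ℕ} {Ω : WeightedSimplicialComplex n} {G : Type*} [Group G]
  [MulAction G (Fin (n + 1))] [MulAction G Ω.MultiFacet]

open Classical in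
/-- The sum of the `G`-orbits of `k` elementary products has rank at most `k |G|`: the labels are
the pairs `(j, h)` of a product and a group element, and the local polynomials vanish on incoherent
labellings. -/
theorem sepRank_sum_orbit_le [Fintype G] (hconn : Ω.IsConnected) (hΩ : Ω.IsGroupAction G)
    (hfree : Ω.IsFreeAction G) {k : ℕ} {F : Fin k → Fin (n + 1) → LocalPoly m}
    (hF : ∀ j i, IsSumSq (F j i)) :
    sepRank hΩ (∑ j, ∑ h : G, ∏ i, atSite i (F j (h⁻¹ • i))) ≤ ((k * Nat.card G : ℕ) : ℕ∞) := by
  obtain ⟨φ, hφ⟩ := hfree.exists_equivariant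
  let e : Fin (k * Nat.card G) ≃ Fin k × G :=
    (Fintype.equivFinOfCardEq (by simp [Nat.card_eq_fintype_card])).symm
  refine sInf_le ⟨_, rfl, fun i β => ∑ jh : Fin k × G,
    if Coherent φ i (e ∘ β) jh then F jh.1 (jh.2⁻¹ • i) else 0, ?_, ?_, ?_⟩
  · rw [← Fintype.sum_prod_type']
    have hpoly : ∀ (i : Fin (n + 1)) (β : Ω.MultiFacetAt i → Fin (k * Nat.card G))
        (jh : Fin k × G), Coherent φ i (e ∘ β) jh →
        (∑ jh' : Fin k × G, if Coherent φ i (e ∘ β) jh' then F jh'.1 (jh'.2⁻¹ • i) else 0) =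
          F jh.1 (jh.2⁻¹ • i) := by
      intro i β jh h
      rw [Finset.sum_eq_single jh (fun jh' _ hne => if_neg fun h' => hne (h'.eq h)) (by simp),
        if_pos h]
    refine Fintype.sum_of_injective
      (fun (jh : Fin k × G) f => e.symm (jh.1, (φ f)⁻¹ * jh.2)) ?_ _ _ ?_ ?_
    · intro jh jh' h
      obtain ⟨f⟩ := Ω.nonempty_multiFacetAt 0
      exact eq_of_labels_eq f.1 (e.symm.injective (congrFun h f.1))
    · intro α hα
      by_contra hne
      refine hα ?_
      obtain ⟨jh, hjh⟩ := exists_forall_eq_of_coherent (α := e ∘ α) (φ := φ) hconn fun i => by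
        by_contra! hi
        refine hne (Finset.prod_eq_zero (Finset.mem_univ i) ?_)
        rw [Finset.sum_eq_zero fun jh _ => if_neg
          (show ¬ Coherent φ i (e ∘ restrict α i) jh from hi jh), atSite, map_zero]
      exact ⟨jh, funext fun f => e.symm_apply_eq.2 (hjh f).symm⟩
    · intro jh
      refine Finset.prod_congr rfl fun i _ => ?_
      rw [hpoly i _ jh fun f => by simp [restrict]]
  · intro i g β
    refine Fintype.sum_equiv ((Equiv.refl (Fin k)).prodCongr (Equiv.mulLeft g)) _ _ fun jh => ?_
    have := coherent_translate_iff hΩ hφ g (e ∘ β) jh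
    change Coherent φ (g • i) (e ∘ translate hΩ g β) _ ↔ _ at this
    exact if_congr this.symm (by simp [mul_smul]) rfl
  · intro i β
    refine IsSumSq.sum fun jh _ => ?_
    split_ifs
    exacts [hF _ _, IsSumSq.zero]

end Rank

/-! ### Approximation by orbit sums -/

section Approximation

open MvPolynomial

variable {n m d : ℕ} {G : Type*} [Group G] [MulAction G (Fin (n + 1))]

theorem abs_eval_rename_gramMap_le (g : G) (M : GramMatrix n m d)
    (x : Fin (n + 1) → Metric.sphere (0 : EuclideanSpace ℝ (Fin (m + 1))) 1) :
    |eval (fun v => (x v.1).1 v.2)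
      (rename (fun v : Fin (n + 1) × Fin (m + 1) => (g • v.1, v.2)) (gramMap M))| ≤
      ‖entries M‖ := by
  rw [eval_rename]
  exact abs_eval_gramMap_le M fun i => x (g • i)

theorem sphereNorm_le_of_mem_gramScalings {p : GlobalPoly n m} {t : ℝ}
    (ht : t ∈ gramScalings G d p) : sphereNorm p ≤ t := by
  obtain ⟨ht0, M, hM, htr, -, rfl⟩ := ht
  refine Real.iSup_le (fun x => ?_) ht0.le
  rw [map_mul, eval_C, abs_mul, abs_of_pos ht0]
  refine mul_le_of_le_one_right ht0.le ((abs_eval_gramMap_le M x).trans ?_)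
  have := convexHull_min (t := Metric.closedBall 0 1)
    (fun x hx => by simpa using norm_le_one_of_mem_productStates x hx)
    (convex_closedBall _ _) (hM.entries_mem_convexHull htr)
  simpa using this

/-- Averaging over `G` the mean of the `k` product states provided by the approximate Carathéodory
theorem does not increase the distance to the invariant polynomial `p`. -/
theorem exists_orbit_sum_approx [Fintype G] {p : GlobalPoly n m} (hinv : IsInvariantPoly G p)
    {t : ℝ} (ht : t ∈ gramScalings G d p) {k : ℕ} (hk : 0 < k) {ε : ℝ} (hε : 0 < ε)
    (hkε : 4 * t ^ 2 < k * ε ^ 2) :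
    ∃ A : Fin k → Fin (n + 1) → Matrix (MonomialIndex m d) (MonomialIndex m d) ℝ,
      (∀ j i, (A j i).PosSemidef) ∧
      sphereNorm (p - ∑ j, ∑ h : G, ∏ i, atSite i (localGram (A j (h⁻¹ • i)))) < ε := by
  obtain ⟨ht0, M, hM, htr, -, hp⟩ := ht
  obtain ⟨x, hx, hdist⟩ := exists_norm_sq_sum_sub_le_of_mem_convexHull
    norm_le_one_of_mem_productStates (hM.entries_mem_convexHull htr) k
  choose B hB _ hxB using hx
  have hG : (0 : ℝ) < Fintype.card G := by exact_mod_cast Fintype.card_pos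
  have hk' : (0 : ℝ) < k := by exact_mod_cast hk
  -- The factor `t / k` of the mean, times the factor `1 / |G|` of the average over `G`.
  set c : ℝ := t / (k * Fintype.card G) with hc
  have hc0 : 0 < c := by positivity
  set N : GramMatrix n m d := -c • ∑ j, (tensorMatrix (B j) - M)
  have hN : ‖entries N‖ = c * ‖∑ j, (x j - entries M)‖ := by
    rw [entries_smul, norm_smul, norm_neg, Real.norm_of_nonneg hc0.le, entries_sum]
    simp only [hxB]
    rfl
  refine ⟨fun j i => (if i = 0 then c else 1) • B j i,
    fun j i => (hB j i).ite_smul hc0.le _ _, ?_⟩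
  -- By invariance of `p`, the error is the sum of the translates of a single Gram polynomial.
  have herr : p - ∑ j, ∑ h : G, ∏ i, atSite i
      (localGram ((if h⁻¹ • i = 0 then c else 1) • B j (h⁻¹ • i))) =
      ∑ h : G, rename (fun v : Fin (n + 1) × Fin (m + 1) => (h • v.1, v.2)) (gramMap N) := by
    have h1 : ∀ (h : G) (j : Fin k), (∏ i, atSite i
        (localGram ((if h⁻¹ • i = 0 then c else 1) • B j (h⁻¹ • i))) : GlobalPoly n m) =
        rename (fun v : Fin (n + 1) × Fin (m + 1) => (h • v.1, v.2))
          (C c * gramMap (tensorMatrix (B j))) := by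
      intro h j
      rw [← gramMap_smul, ← tensorMatrix_smul_first, gramMap_tensorMatrix, rename_smul_prod_atSite]
    have h2 : gramMap N = C ((Fintype.card G : ℝ)⁻¹) * p -
        ∑ j, C c * gramMap (tensorMatrix (B j)) := by
      have h3 : N = (c * k) • M + ∑ j, (-c) • tensorMatrix (B j) := by
        simp only [N, Finset.smul_sum, smul_sub, Finset.sum_sub_distrib, Finset.sum_const,
          Finset.card_univ, Fintype.card_fin, ← Nat.cast_smul_eq_nsmul ℝ, smul_smul]
        module
      have h4 : c * k = (Fintype.card G : ℝ)⁻¹ * t := by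
        rw [hc]
        field_simp
      rw [h3, gramMap_add, gramMap_sum, gramMap_smul, h4, hp, ← mul_assoc, ← C_mul]
      simp only [gramMap_smul, C_neg, neg_mul, Finset.sum_neg_distrib, sub_eq_add_neg]
    rw [Finset.sum_comm]
    simp only [h1, h2, map_sub, map_sum, Finset.sum_sub_distrib]
    congr 1
    have h5 : ∀ h : G, rename (fun v : Fin (n + 1) × Fin (m + 1) => (h • v.1, v.2))
        (C ((Fintype.card G : ℝ)⁻¹) * p) = C ((Fintype.card G : ℝ)⁻¹) * p := fun h => by
      rw [map_mul, rename_C, hinv h]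
    simp only [h5, Finset.sum_const, Finset.card_univ, nsmul_eq_mul]
    rw [← map_natCast (C : ℝ →+* GlobalPoly n m), ← mul_assoc, ← C_mul, mul_inv_cancel₀ hG.ne',
      C_1, one_mul]
  rw [herr]
  refine lt_of_le_of_lt (b := Fintype.card G * ‖entries N‖)
    (Real.iSup_le (fun y => ?_) (by positivity)) ?_
  · rw [map_sum]
    refine (Finset.abs_sum_le_sum_abs _ _).trans ?_
    refine (Finset.sum_le_sum fun h _ => abs_eval_rename_gramMap_le h N y).trans ?_
    simp
  · refine lt_of_pow_lt_pow_left₀ 2 hε.le ?_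
    rw [hN, mul_pow, mul_pow]
    calc (Fintype.card G : ℝ) ^ 2 * (c ^ 2 * ‖∑ j, (x j - entries M)‖ ^ 2)
        ≤ (Fintype.card G : ℝ) ^ 2 * (c ^ 2 * (4 * k)) := by gcongr
      _ = 4 * t ^ 2 / k := by
          rw [hc]
          field_simp
      _ < ε ^ 2 := by
          rw [div_lt_iff₀ hk']
          linarith

end Approximation

theorem mainTheorem8 {n m d : ℕ} {G : Type*} [Group G] [Finite G]
    (Ω : WeightedSimplicialComplex n) (hconn : Ω.IsConnected)
    [MulAction G (Fin (n + 1))] [MulAction G Ω.MultiFacet] (hΩ : Ω.IsGroupAction G)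
    (hfree : Ω.IsFreeAction G)
    (p : GlobalPoly n m) (hhom : IsMultiHomogeneous (2 * d) p)
    (hsep : IsSeparablePoly p) (hinv : IsInvariantPoly G p) :
    (gramScalings G d p).Nonempty ∧
    ∀ ε : ℝ, 0 < ε →
      ∃ q : GlobalPoly n m, IsMultiHomogeneous (2 * d) q ∧
        sphereNorm (p - q) < ε ∧
        sepRank hΩ q ≤
          ((⌈8 * Real.exp 4 * gramMu G d p ^ 2 / ε ^ 2⌉₊ * Nat.card G : ℕ) : ℕ∞) := by
  cases nonempty_fintype G
  have hne := gramScalings_nonempty hhom hsep hinv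
  refine ⟨hne, fun ε hε => ?_⟩
  set k := ⌈8 * Real.exp 4 * gramMu G d p ^ 2 / ε ^ 2⌉₊ with hk
  have hμ : 0 ≤ gramMu G d p := Real.sInf_nonneg fun t ht => ht.1.le
  suffices h : ∃ A : Fin k → Fin (n + 1) → Matrix (MonomialIndex m d) (MonomialIndex m d) ℝ,
      (∀ j i, (A j i).PosSemidef) ∧
      sphereNorm (p - ∑ j, ∑ h : G, ∏ i, atSite i (localGram (A j (h⁻¹ • i)))) < ε by
    obtain ⟨A, hA, hlt⟩ := h
    exact ⟨_, IsMultiHomogeneous.sum _ _ fun j _ => IsMultiHomogeneous.sum _ _ fun h _ =>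
      isMultiHomogeneous_prod_atSite fun i => isHomogeneous_localGram _, hlt,
      sepRank_sum_orbit_le hconn hΩ hfree (F := fun j i => localGram (A j i))
        fun j i => isSumSq_localGram (hA j i)⟩
  rcases hμ.eq_or_lt with h0 | hpos
  · -- If `μ(p) = 0`, then `k = 0`, and `q = 0` is a good approximation.
    have hk0 : k = 0 := by simp [hk, ← h0]
    have : IsEmpty (Fin k) := by rw [hk0]; infer_instance
    refine ⟨isEmptyElim, isEmptyElim, ?_⟩
    obtain ⟨t, ht, htε⟩ := exists_lt_of_csInf_lt hne (show gramMu G d p < ε by rwa [← h0])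
    rw [Finset.univ_eq_empty, Finset.sum_empty, sub_zero]
    exact (sphereNorm_le_of_mem_gramScalings ht).trans_lt htε
  · -- The infimum need not be attained; the constant `8 e⁴ ≥ 16` leaves room for a factor `2`.
    obtain ⟨t, ht, htμ⟩ := exists_lt_of_csInf_lt hne
      (show gramMu G d p < 2 * gramMu G d p by linarith)
    have hkpos : 0 < k := Nat.ceil_pos.2 (by positivity)
    refine exists_orbit_sum_approx hinv ht hkpos hε ?_
    have h1 : 8 * Real.exp 4 * gramMu G d p ^ 2 ≤ k * ε ^ 2 :=
      (div_le_iff₀ (by positivity)).1 (Nat.le_ceil _)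
    have h2 : t ^ 2 < (2 * gramMu G d p) ^ 2 := pow_lt_pow_left₀ htμ ht.1.le two_ne_zero
    have h3 := Real.add_one_le_exp 4
    nlinarith [sq_nonneg (gramMu G d p)]
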